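/- Let $G$ be a compact, Hausdorff, second countable topological group with Borel $\sigma$-algebra $\mathcal B(G)$, let $\mathcal H$ be a complex separable Hilbert space, and let $U$ be a unitary representation of $G$ on $\mathcal H$, i.e. a strongly continuous homomorphism from $G$ into the unitary group of $\mathcal H$. An observable is a map $\mathsf E$ from $\mathcal B(G)$ to the bounded operators on $\mathcal H$ with $0\le\mathsf E(X)\le I$ for all $X$, $\mathsf E(G)=I$, and $\mathsf E(\bigcup_i X_i)=\sum_i\mathsf E(X_i)$ in the weak operator topology for every sequence $(X_i)$ of pairwise disjoint Borel sets. It is $U$-covariant if $U(g)\mathsf E(X)U(g)^*=\mathsf E(gX)$ for all $g\in G$, $X\in\mathcal B(G)$. A state is a positive trace-class operator $\varrho$ on $\mathcal H$ with $\mathrm{tr}\,\varrho=1$. Let $M_1^+(G)$ be the convex set of probability measures on $\mathcal B(G)$, and for an observable $\mathsf E$ and a state $\varrho$ let $\Theta_{\mathsf E}(\varrho)\in M_1^+(G)$ be the measure $X\mapsto\mathrm{tr}(\varrho\,\mathsf E(X))$. Let $\mathsf E$ and $\mathsf F$ be $U$-covariant observables. The following conditions are equivalent: (i) $\mathsf F$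 is a postprocessing of $\mathsf E$: there is an affine map $\Psi:M_1^+(G)\to M_1^+(G)$ (that is, $\Psi(tp+(1-t)q)=t\Psi(p)+(1-t)\Psi(q)$ for all $p,q\in M_1^+(G)$ and $t\in[0,1]$) such that $\Theta_{\mathsf F}=\Psi\circ\Theta_{\mathsf E}$. (ii) There is a probability measure $\nu\in M_1^+(G)$ such that $\mathsf F=\mathsf E_\nu$, i.e. $$\mathsf F(X)=\int_G\nu(g^{-1}X)\,d\mathsf E(g)\qquad\text{for all }X\in\mathcal B(G),$$ where the integral is understood weakly: $\langle x,\mathsf F(X)x\rangle=\int_G\nu(g^{-1}X)\,\langle x,\mathsf E(dg)x\rangle$ for all $x\in\mathcal H$. -/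

import Mathlib

open MeasureTheory
open scoped InnerProductSpace ENNReal NNReal Pointwise

noncomputable section

/-! ### Trace-class operators and states -/

section States

variable (H : Type*) [NormedAddCommGroup H] [InnerProductSpace ℂ H] [CompleteSpace H]

/-- The index set of a fixed Hilbert (i.e. complete orthonormal) basis of `H`. -/
def hBasisIndex : Set H := (exists_hilbertBasis ℂ H).choose

/-- A fixed Hilbert (i.e. complete orthonormal) basis of `H`. -/
def hBasis : HilbertBasis (hBasisIndex H) ℂ H := (exists_hilbertBasis ℂ H).choose_spec.choose

variable {H}

/-- The trace `tr A = ∑ᵢ ⟨eᵢ, A eᵢ⟩` of an operator, along the fixed Hilbert basis. It is only used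
for trace-class operators, for which the series converges absolutely and its sum does not depend on
the Hilbert basis. -/
def opTrace (A : H →L[ℂ] H) : ℂ := ∑' i, ⟪hBasis H i, A (hBasis H i)⟫_ℂ

/-- `A` is trace class: `tr |A| < ∞`, where `|A| = (A* A)^{1/2}`. -/
def IsTraceClass (A : H →L[ℂ] H) : Prop :=
  Summable fun i => (⟪hBasis H i, CFC.abs A (hBasis H i)⟫_ℂ).re

variable (H) in
/-- States: positive trace-class operators of trace one. -/
structure QuantumState where
  op : H →L[ℂ] H
  nonneg : 0 ≤ op
  traceClass : IsTraceClass op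
  trace_eq_one : opTrace op = 1

end States

/-! ### Observables -/

/-- An observable (normalized positive operator valued measure) on the measurable space `Ω`
(below: a topological space with its Borel σ-algebra) with values in the bounded operators on `H`.
It is a function of measurable sets, encoded as in Mathlib's `VectorMeasure` by giving all other
sets the value `0`. The field `iUnion` is countable additivity in the weak operator topology. -/
@[ext]
structure QObservable (Ω : Type*) [MeasurableSpace Ω]
    (H : Type*) [NormedAddCommGroup H] [InnerProductSpace ℂ H] [CompleteSpace H] where
  toFun : Set Ω → (H →L[ℂ] H)
  not_measurable : ∀ X, ¬ MeasurableSet X → toFun X = 0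
  nonneg : ∀ X, MeasurableSet X → 0 ≤ toFun X
  le_one : ∀ X, MeasurableSet X → toFun X ≤ 1
  univ : toFun Set.univ = 1
  iUnion : ∀ X : ℕ → Set Ω, (∀ n, MeasurableSet (X n)) → Pairwise (Function.onFun Disjoint X) →
    ∀ x y : H, HasSum (fun n => ⟪x, toFun (X n) y⟫_ℂ) ⟪x, toFun (⋃ n, X n) y⟫_ℂ

namespace QObservable

variable {Ω : Type*} [MeasurableSpace Ω]
variable {H : Type*} [NormedAddCommGroup H] [InnerProductSpace ℂ H] [CompleteSpace H]

instance : CoeFun (QObservable Ω H) (fun _ => Set Ω → (H →L[ℂ] H)) := ⟨QObservable.toFun⟩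

theorem re_inner_nonneg (E : QObservable Ω H) (X : Set Ω) (x : H) :
    0 ≤ (⟪x, E X x⟫_ℂ).re := by
  by_cases hX : MeasurableSet X
  · exact ((ContinuousLinearMap.nonneg_iff_isPositive _).1 (E.nonneg X hX)).re_inner_nonneg_right x
  · simp [E.not_measurable X hX]

theorem empty (E : QObservable Ω H) : E ∅ = 0 := by
  ext y
  refine ext_inner_left ℂ fun x => ?_
  have h := (E.iUnion (fun _ => ∅) (fun _ => MeasurableSet.empty)
    (fun _ _ _ => Set.disjoint_empty ∅) x y).summable.tendsto_atTop_zero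
  simpa using tendsto_nhds_unique tendsto_const_nhds h

/-- The finite positive measure `X ↦ ⟨x, E(X) x⟩`. -/
def scalarMeasure (E : QObservable Ω H) (x : H) : Measure Ω :=
  Measure.ofMeasurable (fun X _ => ENNReal.ofReal (⟪x, E X x⟫_ℂ).re)
    (by simp [E.empty])
    (by
      intro X hX hd
      have h := Complex.hasSum_re (E.iUnion X hX hd x x)
      rw [← ENNReal.ofReal_tsum_of_nonneg (fun n => E.re_inner_nonneg (X n) x) h.summable,
        h.tsum_eq])

theorem scalarMeasure_apply (E : QObservable Ω H) (x : H) {X : Set Ω} (hX : MeasurableSet X) :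
    E.scalarMeasure x X = ENNReal.ofReal (⟪x, E X x⟫_ℂ).re :=
  Measure.ofMeasurable_apply X hX

/-- `A = ∫ f dE`: the bounded operator `A` is the (weak) integral of the real function `f` with
respect to the operator measure `E`, that is, `⟨x, A x⟩ = ∫ f(ω) ⟨x, E(dω) x⟩` for all `x`. As `H`
is complex, this determines `A`. -/
def HasIntegral (E : QObservable Ω H) (f : Ω → ℝ) (A : H →L[ℂ] H) : Prop :=
  ∀ x : H, Integrable f (E.scalarMeasure x) ∧
    ⟪x, A x⟫_ℂ = ((∫ ω, f ω ∂(E.scalarMeasure x) : ℝ) : ℂ)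

theorem HasIntegral.unique {E : QObservable Ω H} {f : Ω → ℝ} {A B : H →L[ℂ] H}
    (hA : E.HasIntegral f A) (hB : E.HasIntegral f B) : A = B := by
  have h : ((A - B : H →L[ℂ] H) : H →ₗ[ℂ] H) = 0 := by
    rw [← inner_map_self_eq_zero]
    intro x
    have e : ⟪x, (A - B) x⟫_ℂ = 0 := by
      rw [sub_apply, inner_sub_right, (hA x).2, (hB x).2, sub_self]
    exact inner_eq_zero_symm.1 e
  ext x
  exact sub_eq_zero.1 (congrArg (fun T : H →ₗ[ℂ] H => T x) h)

end QObservable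

/-! ### The outcome distribution of an observable in a state -/

section OutcomeDistribution

variable {H : Type*} [NormedAddCommGroup H] [InnerProductSpace ℂ H] [CompleteSpace H]

/-- Cyclicity of the trace in the form `tr (S S T) = ∑ⱼ ⟨S eⱼ, T S eⱼ⟩` for a self-adjoint
Hilbert-Schmidt operator `S`. -/
theorem hasSum_inner_of_hilbertSchmidt {ι : Type*} (b : HilbertBasis ι ℂ H) (S T : H →L[ℂ] H)
    (hS : IsSelfAdjoint S) (hHS : Summable fun i => ‖S (b i)‖ ^ 2) :
    Summable (fun j => ⟪S (b j), T (S (b j))⟫_ℂ) ∧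
      HasSum (fun i => ⟪b i, S (S (T (b i)))⟫_ℂ) (∑' j, ⟪S (b j), T (S (b j))⟫_ℂ) := by
  have hsym : ∀ x y : H, ⟪S x, y⟫_ℂ = ⟪x, S y⟫_ℂ := hS.isSymmetric
  have parseval : ∀ x : H, HasSum (fun i => ‖⟪b i, x⟫_ℂ‖ ^ 2) (‖x‖ ^ 2) := by
    intro x
    have h := Complex.hasSum_re (b.hasSum_inner_mul_inner x x)
    have e2 : (⟪x, x⟫_ℂ).re = ‖x‖ ^ 2 := by
      rw [inner_self_eq_norm_sq_to_K]; norm_cast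
    rw [e2] at h
    convert h using 2 with i
    rw [← inner_conj_symm x (b i), ← Complex.normSq_eq_conj_mul_self, Complex.ofReal_re,
      Complex.normSq_eq_norm_sq]
  have key : ∀ v : ι → H, Summable (fun j => ‖v j‖ ^ 2) →
      Summable (fun p : ι × ι => ‖⟪b p.2, v p.1⟫_ℂ‖ ^ 2) := by
    intro v hv
    rw [summable_prod_of_nonneg (fun _ => by positivity)]
    refine ⟨fun j => (parseval (v j)).summable, ?_⟩
    simpa only [(parseval _).tsum_eq] using hv
  let T' := ContinuousLinearMap.adjoint T
  have hTS : Summable fun j => ‖T' (S (b j))‖ ^ 2 := by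
    refine Summable.of_nonneg_of_le (fun _ => by positivity) (fun j => ?_)
      (hHS.mul_left (‖T'‖ ^ 2))
    rw [← mul_pow]
    exact pow_le_pow_left₀ (norm_nonneg _) (T'.le_opNorm _) 2
  -- the double family, first index `j`, second index `i`
  let a : ι × ι → ℂ := fun p => ⟪T' (S (b p.1)), b p.2⟫_ℂ * ⟪b p.2, S (b p.1)⟫_ℂ
  have ha : Summable a := by
    refine Summable.of_norm_bounded ((key _ hHS).add (key _ hTS)) (fun p => ?_)
    have e : ‖a p‖ = ‖⟪b p.2, T' (S (b p.1))⟫_ℂ‖ * ‖⟪b p.2, S (b p.1)⟫_ℂ‖ := by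
      simp only [a, norm_mul, norm_inner_symm (T' (S (b p.1))) (b p.2)]
    rw [e]
    nlinarith [sq_nonneg (‖⟪b p.2, T' (S (b p.1))⟫_ℂ‖ - ‖⟪b p.2, S (b p.1)⟫_ℂ‖),
      sq_nonneg ‖⟪b p.2, T' (S (b p.1))⟫_ℂ‖, sq_nonneg ‖⟪b p.2, S (b p.1)⟫_ℂ‖]
  have row : ∀ j, HasSum (fun i => a (j, i)) ⟪S (b j), T (S (b j))⟫_ℂ := by
    intro j
    have h := b.hasSum_inner_mul_inner (T' (S (b j))) (S (b j))
    rwa [ContinuousLinearMap.adjoint_inner_left] at h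
  have col : ∀ i, HasSum (fun j => a (j, i)) ⟪b i, S (S (T (b i)))⟫_ℂ := by
    intro i
    have h := b.hasSum_inner_mul_inner (S (b i)) (S (T (b i)))
    rw [hsym (b i)] at h
    have e : (fun j => a (j, i)) = fun j => ⟪S (b i), b j⟫_ℂ * ⟪b j, S (T (b i))⟫_ℂ := by
      funext j
      change ⟪T' (S (b j)), b i⟫_ℂ * ⟪b i, S (b j)⟫_ℂ = _
      rw [ContinuousLinearMap.adjoint_inner_left, hsym (b j), hsym (b i) (b j), mul_comm]
    rw [e]
    exact h
  have h1 : HasSum (fun j => ⟪S (b j), T (S (b j))⟫_ℂ) (∑' p, a p) := ha.hasSum.prod_fiberwise row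
  have h2 : HasSum (fun i => ⟪b i, S (S (T (b i)))⟫_ℂ) (∑' p, a p) :=
    ((Equiv.prodComm ι ι).hasSum_iff.2 ha.hasSum).prod_fiberwise col
  exact ⟨h1.summable, h1.tsum_eq ▸ h2⟩

namespace QuantumState

/-- The vectors `ρ^{1/2} eᵢ`. -/
def vec (ρ : QuantumState H) (i : hBasisIndex H) : H := CFC.sqrt ρ.op (hBasis H i)

theorem summable_and_opTrace_mul (ρ : QuantumState H) (T : H →L[ℂ] H) :
    Summable (fun j => ⟪ρ.vec j, T (ρ.vec j)⟫_ℂ) ∧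
      opTrace (ρ.op * T) = ∑' j, ⟪ρ.vec j, T (ρ.vec j)⟫_ℂ := by
  have hsa : IsSelfAdjoint (CFC.sqrt ρ.op) := IsSelfAdjoint.of_nonneg (CFC.sqrt_nonneg ρ.op)
  have hmul : ∀ x, CFC.sqrt ρ.op (CFC.sqrt ρ.op x) = ρ.op x := fun x =>
    congrArg (fun A : H →L[ℂ] H => A x) (CFC.sqrt_mul_sqrt_self ρ.op ρ.nonneg)
  have hHS : Summable fun i => ‖CFC.sqrt ρ.op (hBasis H i)‖ ^ 2 := by
    have h := ρ.traceClass
    rw [IsTraceClass, CFC.abs_of_nonneg ρ.op ρ.nonneg] at h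
    convert h using 2 with i
    rw [← hmul, ← hsa.isSymmetric.apply_clm, inner_self_eq_norm_sq_to_K]
    norm_cast
  have h := hasSum_inner_of_hilbertSchmidt (hBasis H) (CFC.sqrt ρ.op) T hsa hHS
  refine ⟨h.1, ?_⟩
  have h2 := h.2.tsum_eq
  simp only [hmul] at h2
  exact h2

end QuantumState

namespace QObservable

variable {Ω : Type*} [MeasurableSpace Ω]

theorem ofReal_re_opTrace (E : QObservable Ω H) (ρ : QuantumState H) {X : Set Ω}
    (hX : MeasurableSet X) :
    ENNReal.ofReal (opTrace (ρ.op * E X)).re =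
      Measure.sum (fun j => E.scalarMeasure (ρ.vec j)) X := by
  obtain ⟨h1, h2⟩ := ρ.summable_and_opTrace_mul (E X)
  have h3 := Complex.hasSum_re h1.hasSum
  rw [Measure.sum_apply _ hX, h2, ← h3.tsum_eq,
    ENNReal.ofReal_tsum_of_nonneg (fun j => E.re_inner_nonneg X _) h3.summable]
  simp only [E.scalarMeasure_apply _ hX]

/-- The measure `X ↦ tr (ρ E(X))`. -/
def outcomeMeasure (E : QObservable Ω H) (ρ : QuantumState H) : Measure Ω :=
  Measure.ofMeasurable (fun X _ => ENNReal.ofReal (opTrace (ρ.op * E X)).re)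
    (by simp [E.ofReal_re_opTrace ρ MeasurableSet.empty])
    (by
      intro X hX hd
      simp only [E.ofReal_re_opTrace ρ (hX _), E.ofReal_re_opTrace ρ (MeasurableSet.iUnion hX)]
      exact measure_iUnion hd hX)

theorem outcomeMeasure_apply (E : QObservable Ω H) (ρ : QuantumState H) {X : Set Ω}
    (hX : MeasurableSet X) :
    E.outcomeMeasure ρ X = ENNReal.ofReal (opTrace (ρ.op * E X)).re :=
  Measure.ofMeasurable_apply X hX

/-- The probability measure `X ↦ tr (ρ E(X))`, the outcome distribution of `E` in the state `ρ`. -/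
def outcomeDist (E : QObservable Ω H) (ρ : QuantumState H) : ProbabilityMeasure Ω :=
  ⟨E.outcomeMeasure ρ,
    ⟨by simp [E.outcomeMeasure_apply ρ MeasurableSet.univ, E.univ, ρ.trace_eq_one]⟩⟩

/-- The defining property of `outcomeDist`, as an equation between complex numbers. -/
theorem outcomeDist_apply (E : QObservable Ω H) (ρ : QuantumState H) {X : Set Ω}
    (hX : MeasurableSet X) :
    ((E.outcomeDist ρ X : ℝ) : ℂ) = opTrace (ρ.op * E X) := by
  obtain ⟨h1, h2⟩ := ρ.summable_and_opTrace_mul (E X)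
  have hre := Complex.hasSum_re h1.hasSum
  have him : (opTrace (ρ.op * E X)).im = 0 := by
    rw [h2, ← (Complex.hasSum_im h1.hasSum).tsum_eq]
    refine (tsum_congr fun j => ?_).trans tsum_zero
    have hp := (ContinuousLinearMap.nonneg_iff_isPositive _).1 (E.nonneg X hX)
    exact ((Complex.nonneg_iff.1 (hp.inner_nonneg_right (ρ.vec j))).2).symm
  have hnn : 0 ≤ (opTrace (ρ.op * E X)).re := by
    rw [h2, ← hre.tsum_eq]
    exact tsum_nonneg fun j => E.re_inner_nonneg X _
  have hval : (E.outcomeDist ρ : Measure Ω) X = ENNReal.ofReal (opTrace (ρ.op * E X)).re :=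
    E.outcomeMeasure_apply ρ hX
  have : (E.outcomeDist ρ X : ℝ) = (opTrace (ρ.op * E X)).re := by
    change ((E.outcomeDist ρ : Measure Ω) X).toReal = _
    rw [hval, ENNReal.toReal_ofReal hnn]
  rw [this]
  exact Complex.ext rfl (by simp [him])

end QObservable

end OutcomeDistribution

/-! ### Affine maps on probability measures, postprocessing -/

/-- The convex combination `t p + (1 - t) q` of two probability measures. -/
def probConvexComb {Ω : Type*} [MeasurableSpace Ω] (t : unitInterval)
    (p q : ProbabilityMeasure Ω) : ProbabilityMeasure Ω :=
  ⟨ENNReal.ofReal (t : ℝ) • (p : Measure Ω) + ENNReal.ofReal (1 - (t : ℝ)) • (q : Measure Ω),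
   ⟨by
      simp only [Measure.coe_add, Measure.coe_smul, Pi.add_apply, Pi.smul_apply, measure_univ,
        smul_eq_mul, mul_one]
      rw [← ENNReal.ofReal_add t.2.1 (sub_nonneg.2 t.2.2)]
      simp⟩⟩

/-- A map between sets of probability measures is affine if it preserves convex combinations. -/
def IsAffineProbMap {Ω Ω' : Type*} [MeasurableSpace Ω] [MeasurableSpace Ω']
    (Ψ : ProbabilityMeasure Ω → ProbabilityMeasure Ω') : Prop :=
  ∀ (t : unitInterval) (p q : ProbabilityMeasure Ω),
    Ψ (probConvexComb t p q) = probConvexComb t (Ψ p) (Ψ q)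

/-- `F` is a postprocessing of `E`: there is an affine map `Ψ` on probability measures which maps
the outcome distribution of `E` to that of `F`, for every state. -/
def QObservable.IsPostprocessingOf {Ω : Type*} [MeasurableSpace Ω]
    {H : Type*} [NormedAddCommGroup H] [InnerProductSpace ℂ H] [CompleteSpace H]
    (F E : QObservable Ω H) : Prop :=
  ∃ Ψ : ProbabilityMeasure Ω → ProbabilityMeasure Ω,
    IsAffineProbMap Ψ ∧ F.outcomeDist = Ψ ∘ E.outcomeDist

/-! ### Covariance -/

/-- A unitary representation: a strongly continuous homomorphism into the unitary group. -/
structure UnitaryRep (G : Type*) [Group G] [TopologicalSpace G]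
    (H : Type*) [NormedAddCommGroup H] [InnerProductSpace ℂ H] [CompleteSpace H] where
  toHom : G →* unitary (H →L[ℂ] H)
  continuous_apply : ∀ x : H, Continuous fun g => (toHom g : H →L[ℂ] H) x

/-- `E` is covariant with respect to `U`: `U(g) E(X) U(g)* = E(gX)` for all `g` and all measurable
`X`. -/
def QObservable.IsCovariant {G : Type*} [Group G] [TopologicalSpace G] [MeasurableSpace G]
    {H : Type*} [NormedAddCommGroup H] [InnerProductSpace ℂ H] [CompleteSpace H]
    (E : QObservable G H) (U : UnitaryRep G H) : Prop :=
  ∀ (g : G) (X : Set G), MeasurableSet X →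
    (U.toHom g : H →L[ℂ] H) * E X * star (U.toHom g : H →L[ℂ] H) = E (g • X)

/-- `F = E_ν`, that is, `F(X) = ∫ ν(g⁻¹X) dE(g)` for all measurable `X`. -/
def QObservable.IsSmearing {G : Type*} [Group G] [MeasurableSpace G]
    {H : Type*} [NormedAddCommGroup H] [InnerProductSpace ℂ H] [CompleteSpace H]
    (F E : QObservable G H) (ν : ProbabilityMeasure G) : Prop :=
  ∀ X : Set G, MeasurableSet X → E.HasIntegral (fun g => (ν (g⁻¹ • X) : ℝ)) (F X)

end

/-! ### Approximation along countable partitions -/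

section Partition

open MeasurableSpace ProbabilityTheory Filter Topology

variable {α : Type*} [MeasurableSpace α]

/-! Write `E_x` for `E.scalarMeasure x`. The affine map `Ψ` extends to a linear, mass preserving map
`T` on finite measures. Nothing else is known about `T`: it need not be weakly continuous, and it
need not commute with translations in general. But positivity and mass preservation make it
continuous in total variation. For unit vectors `T E_x = F_x`, and covariance says that translating
`E_x` by `h` gives `E_{U(h)x}`, likewise for `F`. So `T` commutes with the translations of each such
`p = E_x`. Covariance also gives `E_x ≪ μ`, with `μ` the Haar probability measure.

If `T` were weakly continuous and equivariant, `ν` would be the image of the point mass at the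
identity. As a substitute, let `σ_n` be the average over `h` of `h⁻¹ · T(μ|_A / μ(A))`, where `A` is
the cell containing `h` of the `n`-th partition of `G` (`averagedImage`). Invariance of `μ` turns `p
* σ_n` into the average over `h` of `h⁻¹ · T((hp)_n)`, where `(hp)_n` is `hp` averaged over the
cells (`lintegral_mconv_averagedImage`). Martingale convergence gives `(hp)_n → hp` in total
variation (`exists_decomposition_partition`), hence `T((hp)_n) → T(hp) = h · T p`, and `p * σ_n → T
p` weakly. By compactness the `σ_n` have a weak limit point `ν`, independent of `p`, and `T p = p *
ν` (`exists_mconv_eq`). Thus `F_x = E_x * ν`, which is the smearing identity (`isSmearing_iff`).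
Conversely, convolution with `ν` is an affine map. -/

theorem div_mul_self_of_absolutelyContinuous {q μ : Measure α} [IsFiniteMeasure μ] (h : q ≪ μ)
    (A : Set α) : q A / μ A * μ A = q A := by
  by_cases h0 : μ A = 0
  · simp [h0, h h0]
  · exact ENNReal.div_mul_cancel h0 (measure_ne_top _ _)

theorem div_ne_top_of_absolutelyContinuous {q μ : Measure α} [IsFiniteMeasure q] (h : q ≪ μ)
    (A : Set α) : q A / μ A ≠ ∞ := by
  by_cases h0 : μ A = 0
  · simp [h0, h h0]
  · exact ENNReal.div_ne_top (measure_ne_top _ _) h0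

variable [CountablyGenerated α]

variable (α) in
/-- The sets of `countablePartition α n`, as a finset. -/
noncomputable def partitionFinset (n : ℕ) : Finset (Set α) := (finite_countablePartition α n).toFinset

theorem mem_partitionFinset {n : ℕ} {A : Set α} :
    A ∈ partitionFinset α n ↔ A ∈ countablePartition α n :=
  Set.Finite.mem_toFinset _

theorem measurableSet_of_mem_partitionFinset {n : ℕ} {A : Set α} (hA : A ∈ partitionFinset α n) :
    MeasurableSet A :=
  measurableSet_countablePartition n (mem_partitionFinset.1 hA)

theorem sum_measure_partitionFinset (q : Measure α) (n : ℕ) :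
    ∑ A ∈ partitionFinset α n, q A = q Set.univ := by
  rw [← sUnion_countablePartition α n, Set.sUnion_eq_biUnion,
    ← measure_biUnion_finset (fun s hs t ht hst => disjoint_countablePartition
      (mem_partitionFinset.1 hs) (mem_partitionFinset.1 ht) hst)
      (fun s hs => measurableSet_of_mem_partitionFinset hs)]
  simp only [mem_partitionFinset]

/-- The density of `q` with respect to `μ`, averaged over the sets of `countablePartition α n`. -/
noncomputable def partitionDensity (q μ : Measure α) (n : ℕ) (x : α) : ℝ≥0∞ :=
  -- A cell with `μ A = 0` does no harm when `q ≪ μ`: then `q A = 0`, and `0 / 0 = 0` in `ℝ≥0∞`.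
  ∑ A ∈ partitionFinset α n, A.indicator (fun _ => q A / μ A) x

theorem measurable_partitionDensity_filtration (q μ : Measure α) (n : ℕ) :
    Measurable[countableFiltration α n] (partitionDensity q μ n) := by
  refine Finset.measurable_sum _ fun A hA => ?_
  exact Measurable.indicator measurable_const
    (measurableSet_countableFiltration_of_mem n (mem_partitionFinset.1 hA))

theorem measurable_partitionDensity (q μ : Measure α) (n : ℕ) :
    Measurable (partitionDensity q μ n) :=
  (measurable_partitionDensity_filtration q μ n).mono ((countableFiltration α).le n) le_rfl

theorem withDensity_partitionDensity (q μ : Measure α) (n : ℕ) :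
    μ.withDensity (partitionDensity q μ n) =
      ∑ A ∈ partitionFinset α n, (q A / μ A) • μ.restrict A := by
  ext s hs
  rw [withDensity_apply _ hs]
  simp only [partitionDensity]
  rw [lintegral_finsetSum' _ fun A hA =>
    (measurable_const.indicator (measurableSet_of_mem_partitionFinset hA)).aemeasurable]
  rw [Measure.finsetSum_apply]
  refine Finset.sum_congr rfl fun A hA => ?_
  rw [lintegral_indicator_const (measurableSet_of_mem_partitionFinset hA), Measure.smul_apply,
    smul_eq_mul, Measure.restrict_apply (measurableSet_of_mem_partitionFinset hA),
    Measure.restrict_apply hs, Set.inter_comm]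

/-- A set measurable at level `n` is a finite union of cells, and averaging does not change the mass
of a cell. This is what identifies `partitionDensity` as a conditional expectation. -/
theorem withDensity_partitionDensity_apply {q μ : Measure α} [IsFiniteMeasure μ] (h : q ≪ μ)
    {n : ℕ} {s : Set α} (hs : MeasurableSet[countableFiltration α n] s) :
    μ.withDensity (partitionDensity q μ n) s = q s := by
  obtain ⟨S, hS, rfl⟩ := (measurableSet_generateFrom_countablePartition_iff n s).1 hs
  have hd : (S : Set (Set α)).Pairwise Disjoint := fun s hs t ht hst =>
    disjoint_countablePartition (hS hs) (hS ht) hst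
  have hm : ∀ A ∈ (S : Set (Set α)), MeasurableSet A := fun A hA =>
    measurableSet_countablePartition n (hS hA)
  rw [measure_sUnion S.countable_toSet hd hm, measure_sUnion S.countable_toSet hd hm]
  refine tsum_congr fun B => ?_
  have hB := mem_partitionFinset.2 (hS B.2)
  rw [withDensity_partitionDensity, Measure.finsetSum_apply, Finset.sum_eq_single (B : Set α)]
  · rw [Measure.smul_apply, smul_eq_mul, Measure.restrict_apply (hm _ B.2), Set.inter_self,
      div_mul_self_of_absolutelyContinuous h]
  · intro A hA hAB
    rw [Measure.smul_apply, smul_eq_mul, Measure.restrict_apply (hm _ B.2),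
      (disjoint_countablePartition (hS B.2) (mem_partitionFinset.1 hA) hAB.symm).inter_eq,
      measure_empty, mul_zero]
  · exact fun h => absurd hB h

theorem partitionDensity_ne_top {q μ : Measure α} [IsFiniteMeasure q] (h : q ≪ μ) (n : ℕ) (x : α) :
    partitionDensity q μ n x ≠ ∞ := by
  refine ENNReal.sum_ne_top.2 fun A _ => ?_
  by_cases hx : x ∈ A
  · simpa [hx] using div_ne_top_of_absolutelyContinuous h A
  · simp [hx]

/-- The averaged densities converge in `L¹`. -/
theorem tendsto_eLpNorm_partitionDensity {q μ : Measure α} [IsFiniteMeasure q] [IsFiniteMeasure μ]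
    (h : q ≪ μ) :
    Tendsto (fun n => ∫⁻ x, ‖(partitionDensity q μ n x).toReal - (q.rnDeriv μ x).toReal‖ₑ ∂μ)
      atTop (𝓝 0) := by
  have hg : Integrable (fun x => (q.rnDeriv μ x).toReal) μ := Measure.integrable_toReal_rnDeriv
  -- The cells of all levels generate the whole σ-algebra, so the martingale limit is the density
  -- itself.
  have hgm : StronglyMeasurable[⨆ n, countableFiltration α n]
      (fun x => (q.rnDeriv μ x).toReal) := by
    rw [iSup_countableFiltration]
    exact (Measure.measurable_rnDeriv q μ).ennreal_toReal.stronglyMeasurable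
  refine (hg.tendsto_eLpNorm_condExp hgm).congr fun n => ?_
  rw [eLpNorm_one_eq_lintegral_enorm]
  have hfin : ∀ s, ∫⁻ x in s, partitionDensity q μ n x ∂μ ≠ ∞ := fun s =>
    ((setLIntegral_le_lintegral s _).trans_lt (by
      rw [← setLIntegral_univ, ← withDensity_apply _ MeasurableSet.univ,
        withDensity_partitionDensity_apply h MeasurableSet.univ]
      exact measure_lt_top _ _)).ne
  have hint : Integrable (fun x => (partitionDensity q μ n x).toReal) μ :=
    integrable_toReal_of_lintegral_ne_top (measurable_partitionDensity q μ n).aemeasurable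
      (by simpa using hfin Set.univ)
  have key := ae_eq_condExp_of_forall_setIntegral_eq ((countableFiltration α).le n) hg
    (g := fun x => (partitionDensity q μ n x).toReal) (fun s _ _ => hint.integrableOn)
    (fun s hs _ => by
      have hs' := (countableFiltration α).le n s hs
      rw [Measure.setIntegral_toReal_rnDeriv h, integral_toReal
        (measurable_partitionDensity q μ n).aemeasurable
        (ae_of_all _ fun x => (partitionDensity_ne_top h n x).lt_top),
        ← withDensity_apply _ hs', withDensity_partitionDensity_apply h hs]
      rfl)
    (measurable_partitionDensity_filtration q μ n).ennreal_toReal.aestronglyMeasurable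
  refine lintegral_congr_ae ?_
  filter_upwards [key] with x hx
  simp only [Pi.sub_apply, ← hx]

/-- The averages of `q` over the sets of `countablePartition α n` converge to `q` in total
variation. -/
theorem exists_decomposition_partition {q μ : Measure α} [IsFiniteMeasure q] [IsFiniteMeasure μ]
    (h : q ≪ μ) :
    ∃ m r s : ℕ → Measure α, (∀ n, q = m n + r n) ∧
      (∀ n, ∑ A ∈ partitionFinset α n, (q A / μ A) • μ.restrict A = m n + s n) ∧
      Tendsto (fun n => r n Set.univ) atTop (𝓝 0) ∧
      Tendsto (fun n => s n Set.univ) atTop (𝓝 0) := by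
  set φ := q.rnDeriv μ with hφ
  have hφm : Measurable φ := Measure.measurable_rnDeriv q μ
  have hψm := measurable_partitionDensity q μ
  have hφt : ∀ᵐ x ∂μ, φ x ≠ ∞ := Measure.rnDeriv_ne_top q μ
  have hL := tendsto_eLpNorm_partitionDensity h
  have bound : ∀ a b : ℝ≥0∞, a ≠ ∞ → b ≠ ∞ → a - b ≤ ‖a.toReal - b.toReal‖ₑ := by
    intro a b ha hb
    lift a to ℝ≥0 using ha
    lift b to ℝ≥0 using hb
    rw [← ENNReal.coe_sub, Real.enorm_eq_ofReal_abs, ENNReal.coe_toReal, ENNReal.coe_toReal,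
      ← ENNReal.ofReal_coe_nnreal]
    refine ENNReal.ofReal_le_ofReal ?_
    rw [NNReal.coe_sub_def]
    exact max_le (le_abs_self _) (abs_nonneg _)
  -- The common part `m n` has the minimum of the two densities, `r n` and `s n` the two truncated
  -- differences. This replaces a signed difference, on which a map that is only `ℝ≥0`-linear is not
  -- defined.
  refine ⟨fun n => μ.withDensity fun x => min (φ x) (partitionDensity q μ n x),
    fun n => μ.withDensity fun x => φ x - partitionDensity q μ n x,
    fun n => μ.withDensity fun x => partitionDensity q μ n x - φ x, fun n => ?_, fun n => ?_, ?_, ?_⟩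
  · rw [← withDensity_add_left (hφm.min (hψm n))]
    conv_lhs => rw [← Measure.withDensity_rnDeriv_eq q μ h]
    congr 1
    funext x
    simp only [Pi.add_apply, ← hφ]
    rcases le_total (φ x) (partitionDensity q μ n x) with h1 | h1
    · rw [min_eq_left h1, tsub_eq_zero_of_le h1, add_zero]
    · rw [min_eq_right h1, add_tsub_cancel_of_le h1]
  · rw [← withDensity_add_left (hφm.min (hψm n)), ← withDensity_partitionDensity]
    congr 1
    funext x
    simp only [Pi.add_apply]
    rcases le_total (φ x) (partitionDensity q μ n x) with h1 | h1
    · rw [min_eq_left h1, add_tsub_cancel_of_le h1]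
    · rw [min_eq_right h1, tsub_eq_zero_of_le h1, add_zero]
  · refine tendsto_of_tendsto_of_tendsto_of_le_of_le tendsto_const_nhds hL (fun _ => zero_le)
      fun n => ?_
    simp only [withDensity_apply _ MeasurableSet.univ, setLIntegral_univ]
    refine lintegral_mono_ae ?_
    filter_upwards [hφt] with x hx
    refine (bound _ _ hx (partitionDensity_ne_top h n x)).trans_eq ?_
    rw [← enorm_neg, neg_sub]
  · refine tendsto_of_tendsto_of_tendsto_of_le_of_le tendsto_const_nhds hL (fun _ => zero_le)
      fun n => ?_
    simp only [withDensity_apply _ MeasurableSet.univ, setLIntegral_univ]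
    refine lintegral_mono_ae ?_
    filter_upwards [hφt] with x hx
    exact bound _ _ (partitionDensity_ne_top h n x) hx

end Partition

/-! ### Linear extension of affine maps on probability measures -/

section LinearExtension

variable {Ω Ω' : Type*} [MeasurableSpace Ω] [MeasurableSpace Ω']

theorem toFiniteMeasure_probConvexComb (t : unitInterval) (p q : ProbabilityMeasure Ω) :
    (probConvexComb t p q).toFiniteMeasure =
      Real.toNNReal t • p.toFiniteMeasure + Real.toNNReal (1 - t) • q.toFiniteMeasure :=
  rfl

/-- Comparing total masses gives `c = a + b`, so for `c ≠ 0` the measure `r` is the convex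
combination of `p` and `q` with weight `a / c`. Both additivity and homogeneity of the linear
extension are instances. -/
theorem IsAffineProbMap.map_combination {Ψ : ProbabilityMeasure Ω → ProbabilityMeasure Ω'}
    (hΨ : IsAffineProbMap Ψ) (a b c : ℝ≥0) (p q r : ProbabilityMeasure Ω)
    (h : c • r.toFiniteMeasure = a • p.toFiniteMeasure + b • q.toFiniteMeasure) :
    c • (Ψ r).toFiniteMeasure = a • (Ψ p).toFiniteMeasure + b • (Ψ q).toFiniteMeasure := by
  have hc : c = a + b := by
    have := congrArg (fun m : FiniteMeasure Ω => m Set.univ) h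
    simpa using this
  rcases eq_or_ne c 0 with h0 | h0
  · obtain ⟨rfl, rfl⟩ : a = 0 ∧ b = 0 := by simpa [h0] using hc.symm
    simp [h0]
  have hc0 : (0 : ℝ) < c := NNReal.coe_pos.2 (pos_iff_ne_zero.2 h0)
  have hcr : (c : ℝ) = a + b := by exact_mod_cast hc
  let t : unitInterval := ⟨a / c, by positivity, (div_le_one hc0).2 (by rw [hcr]; simp)⟩
  have ht : c * Real.toNNReal t = a := by
    ext
    rw [NNReal.coe_mul, Real.coe_toNNReal _ t.2.1]
    simp only [t]
    field_simp
  have ht' : c * Real.toNNReal (1 - t) = b := by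
    ext
    rw [NNReal.coe_mul, Real.coe_toNNReal _ (sub_nonneg.2 t.2.2)]
    simp only [t]
    field_simp
    linarith
  have hr : r = probConvexComb t p q := by
    have h1 : c • r.toFiniteMeasure = c • (probConvexComb t p q).toFiniteMeasure := by
      rw [h, toFiniteMeasure_probConvexComb, smul_add, smul_smul, smul_smul, ht, ht']
    have h2 := congrArg (fun m => c⁻¹ • m) h1
    simp only [smul_smul, inv_mul_cancel₀ h0, one_smul] at h2
    exact Subtype.ext (congrArg (fun m : FiniteMeasure Ω => (m : Measure Ω)) h2)
  rw [hr, hΨ, toFiniteMeasure_probConvexComb, smul_add, smul_smul, smul_smul, ht, ht']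

/-- The extension of an affine map on probability measures to a linear map on finite measures. -/
noncomputable def IsAffineProbMap.linearExtension [Nonempty Ω]
    {Ψ : ProbabilityMeasure Ω → ProbabilityMeasure Ω'} (hΨ : IsAffineProbMap Ψ) :
    FiniteMeasure Ω →ₗ[ℝ≥0] FiniteMeasure Ω' where
  -- For `m = 0` the normalization is an arbitrary probability measure, which the factor `m.mass =
  -- 0` removes.
  toFun m := m.mass • (Ψ m.normalize).toFiniteMeasure
  map_add' m n := hΨ.map_combination _ _ _ _ _ _ (by
    rw [← FiniteMeasure.self_eq_mass_smul_normalize, ← FiniteMeasure.self_eq_mass_smul_normalize,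
      ← FiniteMeasure.self_eq_mass_smul_normalize])
  map_smul' c m := by
    have h := hΨ.map_combination (c * m.mass) 0 (c • m).mass m.normalize m.normalize
      (c • m).normalize (by
        rw [← FiniteMeasure.self_eq_mass_smul_normalize, mul_smul,
          ← FiniteMeasure.self_eq_mass_smul_normalize, zero_smul, add_zero])
    rwa [zero_smul, add_zero, mul_smul] at h

theorem IsAffineProbMap.linearExtension_apply [Nonempty Ω]
    {Ψ : ProbabilityMeasure Ω → ProbabilityMeasure Ω'} (hΨ : IsAffineProbMap Ψ)
    (p : ProbabilityMeasure Ω) :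
    hΨ.linearExtension p.toFiniteMeasure = (Ψ p).toFiniteMeasure := by
  change p.toFiniteMeasure.mass • (Ψ p.toFiniteMeasure.normalize).toFiniteMeasure = _
  rw [ProbabilityMeasure.mass_toFiniteMeasure, one_smul,
    ProbabilityMeasure.toFiniteMeasure_normalize_eq_self]

theorem IsAffineProbMap.mass_linearExtension [Nonempty Ω]
    {Ψ : ProbabilityMeasure Ω → ProbabilityMeasure Ω'} (hΨ : IsAffineProbMap Ψ)
    (m : FiniteMeasure Ω) : (hΨ.linearExtension m).mass = m.mass := by
  change (m.mass • (Ψ m.normalize).toFiniteMeasure) Set.univ = _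
  simp

end LinearExtension

/-! ### Linear maps on finite measures of a compact group -/

section Group

open Filter Topology BoundedContinuousFunction

variable {G : Type*} [MeasurableSpace G]

/-- The restriction of `μ` to `A`, as a finite measure. -/
noncomputable def restrictFinite (μ : Measure G) [IsFiniteMeasure μ] (A : Set G) : FiniteMeasure G :=
  ⟨μ.restrict A, inferInstance⟩

theorem toMeasure_linearMap_sum (T : FiniteMeasure G →ₗ[ℝ≥0] FiniteMeasure G) {ι : Type*}
    (s : Finset ι) (c : ι → ℝ≥0) (m : ι → FiniteMeasure G) :
    (T (∑ i ∈ s, c i • m i) : Measure G) = ∑ i ∈ s, c i • (T (m i) : Measure G) := by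
  rw [map_sum, FiniteMeasure.toMeasure_sum]
  simp

theorem toMeasure_linearMap_univ {T : FiniteMeasure G →ₗ[ℝ≥0] FiniteMeasure G}
    (hT : ∀ m, (T m).mass = m.mass) (m : FiniteMeasure G) :
    (T m : Measure G) Set.univ = (m : Measure G) Set.univ := by
  rw [← FiniteMeasure.ennreal_mass, hT, FiniteMeasure.ennreal_mass]

theorem lintegral_le_norm_mul [TopologicalSpace G] (f : G →ᵇ ℝ≥0) (m : Measure G) (u : G → G) :
    ∫⁻ x, f (u x) ∂m ≤ nndist f 0 * m Set.univ :=
  (lintegral_mono fun x => ENNReal.coe_le_coe.2 (BoundedContinuousFunction.NNReal.upper_bound f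
    (u x))).trans_eq (lintegral_const _)

/-- Since `T` preserves mass, the images of the remainders `r n` and `s n` have masses tending to
zero, so their integrals of the bounded `f` vanish in the limit. The common part cancels, and no
continuity of `T` is needed. -/
theorem tendsto_lintegral_partition [TopologicalSpace G] [MeasurableSpace.CountablyGenerated G]
    [OpensMeasurableSpace G]
    {T : FiniteMeasure G →ₗ[ℝ≥0] FiniteMeasure G} (hT : ∀ m, (T m).mass = m.mass)
    {μ : Measure G} [IsFiniteMeasure μ] {q : FiniteMeasure G} (h : (q : Measure G) ≪ μ)
    (f : G →ᵇ ℝ≥0) :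
    Tendsto (fun n => ∑ A ∈ partitionFinset G n, (q : Measure G) A / μ A *
      ∫⁻ x, f x ∂(T (restrictFinite μ A) : Measure G)) atTop
      (𝓝 (∫⁻ x, f x ∂(T q : Measure G))) := by
  obtain ⟨m, r, s, hq, hs, hr0, hs0⟩ := exists_decomposition_partition h
  have hfin : ∀ n, IsFiniteMeasure (m n) ∧ IsFiniteMeasure (r n) := fun n => by
    have h1 : (q : Measure G) Set.univ < ∞ := measure_lt_top _ _
    rw [hq n, Measure.add_apply] at h1
    exact ⟨⟨(le_self_add).trans_lt h1⟩, ⟨(le_add_self).trans_lt h1⟩⟩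
  let w : Set G → ℝ≥0 := fun A => ((q : Measure G) A / μ A).toNNReal
  have hw : ∀ A, (w A : ℝ≥0∞) = (q : Measure G) A / μ A := fun A =>
    ENNReal.coe_toNNReal (div_ne_top_of_absolutelyContinuous h A)
  let qn : ℕ → FiniteMeasure G := fun n => ∑ A ∈ partitionFinset G n, w A • restrictFinite μ A
  have hqn : ∀ n, (qn n : Measure G) = m n + s n := fun n => by
    rw [← hs n, FiniteMeasure.toMeasure_sum]
    refine Finset.sum_congr rfl fun A _ => ?_
    rw [← hw]
    rfl
  have hfins : ∀ n, IsFiniteMeasure (s n) := fun n => by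
    have h1 : (qn n : Measure G) Set.univ < ∞ := measure_lt_top _ _
    rw [hqn n, Measure.add_apply] at h1
    exact ⟨(le_add_self).trans_lt h1⟩
  let m' : ℕ → FiniteMeasure G := fun n => ⟨m n, (hfin n).1⟩
  let r' : ℕ → FiniteMeasure G := fun n => ⟨r n, (hfin n).2⟩
  let s' : ℕ → FiniteMeasure G := fun n => ⟨s n, hfins n⟩
  have hq' : ∀ n, q = m' n + r' n := fun n => Subtype.ext (hq n)
  have hqn' : ∀ n, qn n = m' n + s' n := fun n => Subtype.ext (hqn n)
  set a := ∫⁻ x, f x ∂(T q : Measure G) with ha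
  let ar : ℕ → ℝ≥0∞ := fun n => ∫⁻ x, f x ∂(T (r' n) : Measure G)
  let as' : ℕ → ℝ≥0∞ := fun n => ∫⁻ x, f x ∂(T (s' n) : Measure G)
  let am : ℕ → ℝ≥0∞ := fun n => ∫⁻ x, f x ∂(T (m' n) : Measure G)
  have hsplit : ∀ n, a = am n + ar n := fun n => by
    rw [ha, hq' n, map_add, FiniteMeasure.toMeasure_add, lintegral_add_measure]
  have hsum : ∀ n, ∑ A ∈ partitionFinset G n, (q : Measure G) A / μ A *
      ∫⁻ x, f x ∂(T (restrictFinite μ A) : Measure G) = am n + as' n := fun n => by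
    have : am n + as' n = ∫⁻ x, f x ∂(T (qn n) : Measure G) := by
      rw [hqn' n, map_add, FiniteMeasure.toMeasure_add, lintegral_add_measure]
    rw [this, toMeasure_linearMap_sum, lintegral_finsetSum_measure]
    refine Finset.sum_congr rfl fun A _ => ?_
    rw [← hw]
    exact (lintegral_smul_measure (w A : ℝ≥0∞) _).symm
  have small : ∀ {t : ℕ → FiniteMeasure G},
      Tendsto (fun n => (t n : Measure G) Set.univ) atTop (𝓝 0) →
      Tendsto (fun n => ∫⁻ x, f x ∂(T (t n) : Measure G)) atTop (𝓝 0) := fun {t} ht => by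
    have h1 := ENNReal.Tendsto.const_mul (a := (nndist f 0 : ℝ≥0∞)) ht
      (Or.inr ENNReal.coe_ne_top)
    rw [mul_zero] at h1
    refine tendsto_of_tendsto_of_tendsto_of_le_of_le tendsto_const_nhds h1
      (fun _ => zero_le) fun n => ?_
    have h2 := lintegral_le_norm_mul f (T (t n) : Measure G) id
    rwa [toMeasure_linearMap_univ hT] at h2
  have har : Tendsto ar atTop (𝓝 0) := small hr0
  have has : Tendsto as' atTop (𝓝 0) := small hs0
  have hafin : a ≠ ∞ := ((lintegral_le_norm_mul f (T q : Measure G) id).trans_lt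
    (ENNReal.mul_lt_top ENNReal.coe_lt_top (measure_lt_top _ _))).ne
  have ham : Tendsto am atTop (𝓝 a) := by
    have h1 : am = fun n => a - ar n := by
      funext n
      have : ar n ≠ ∞ := ne_top_of_le_ne_top hafin (by rw [hsplit n]; exact le_add_self)
      rw [hsplit n, ENNReal.add_sub_cancel_right this]
    rw [h1]
    simpa using ENNReal.Tendsto.sub (tendsto_const_nhds (x := a)) har (Or.inl hafin)
  simp only [hsum]
  simpa using ham.add has

variable [Group G] [TopologicalSpace G] [IsTopologicalGroup G]
  [BorelSpace G]

/-- The left translate of a finite measure. -/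
noncomputable def leftTranslate (h : G) (m : FiniteMeasure G) : FiniteMeasure G :=
  ⟨(m : Measure G).map (h * ·), inferInstance⟩

theorem leftTranslate_apply (p : FiniteMeasure G) {A : Set G} (hA : MeasurableSet A) (h : G) :
    (leftTranslate h p : Measure G) A = ∫⁻ g, A.indicator 1 (h * g) ∂(p : Measure G) := by
  rw [← lintegral_indicator_one hA]
  exact lintegral_map (measurable_one.indicator hA) (measurable_const_mul h)

theorem leftTranslate_absolutelyContinuous {μ : Measure G} [μ.IsMulLeftInvariant]
    {p : FiniteMeasure G} (hp : (p : Measure G) ≪ μ) (h : G) :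
    (leftTranslate h p : Measure G) ≪ μ := by
  have := hp.map (measurable_const_mul h)
  rwa [map_mul_left_eq_self μ h] at this

variable [SecondCountableTopology G]

theorem measurable_lintegral_inv_mul (f : G →ᵇ ℝ≥0) (m : Measure G) [SFinite m] :
    Measurable fun h : G => ∫⁻ x, f (h⁻¹ * x) ∂m :=
  Measurable.lintegral_prod_right' (f := fun z : G × G => (f (z.1⁻¹ * z.2) : ℝ≥0∞))
    (f.continuous.measurable.coe_nnreal_ennreal.comp (by fun_prop))

theorem measurable_leftTranslate_apply (p : FiniteMeasure G) {A : Set G} (hA : MeasurableSet A) :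
    Measurable fun h => (leftTranslate h p : Measure G) A := by
  simp only [leftTranslate_apply p hA]
  exact Measurable.lintegral_prod_right'
    (f := fun z : G × G => A.indicator (1 : G → ℝ≥0∞) (z.1 * z.2))
    ((measurable_one.indicator hA).comp measurable_mul)

/-- The average over `h` of the translates by `h⁻¹` of the images under `T` of the normalized
restriction of `μ` to the set of `countablePartition G n` containing `h`. -/
noncomputable def averagedImage (T : FiniteMeasure G →ₗ[ℝ≥0] FiniteMeasure G) (μ : Measure G)
    [IsFiniteMeasure μ] (n : ℕ) : Measure G :=
  ∑ A ∈ partitionFinset G n, (μ A)⁻¹ •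
    ((μ.restrict A).map (·⁻¹) ∗ₘ (T (restrictFinite μ A) : Measure G))

/-- A cell contributes `(μ A)⁻¹ * μ A * μ A`, which is `μ A` also for a null cell because `∞ * 0 =
0`. -/
theorem averagedImage_univ {T : FiniteMeasure G →ₗ[ℝ≥0] FiniteMeasure G}
    (hT : ∀ m, (T m).mass = m.mass) (μ : Measure G) [IsProbabilityMeasure μ] (n : ℕ) :
    averagedImage T μ n Set.univ = 1 := by
  rw [averagedImage, Measure.finsetSum_apply, ← measure_univ (μ := μ),
    ← sum_measure_partitionFinset μ n]
  refine Finset.sum_congr rfl fun A hA => ?_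
  have h1 : (T (restrictFinite μ A) : Measure G) Set.univ = μ A := by
    rw [toMeasure_linearMap_univ hT]
    exact Measure.restrict_apply_univ A
  rw [Measure.smul_apply, Measure.mconv, Measure.map_apply measurable_mul MeasurableSet.univ,
    Set.preimage_univ, Measure.prod_apply MeasurableSet.univ]
  simp only [Set.preimage_univ, h1, lintegral_const, smul_eq_mul]
  rw [Measure.map_apply measurable_inv MeasurableSet.univ, Set.preimage_univ,
    Measure.restrict_apply_univ, ← mul_assoc, mul_comm (μ A)⁻¹, ← div_eq_mul_inv,
    div_mul_self_of_absolutelyContinuous Measure.AbsolutelyContinuous.rfl]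

/-- Substituting `h * g` for `h`, by right invariance, turns `g * h⁻¹` into `h⁻¹` and moves `g` into
the indicator of the cell. Integrating that indicator over `g` against `p` gives the mass of the
cell under the translate of `p` by `h`. -/
theorem lintegral_mconv_averagedImage (T : FiniteMeasure G →ₗ[ℝ≥0] FiniteMeasure G)
    (μ : Measure G) [IsFiniteMeasure μ] [μ.IsMulRightInvariant] (n : ℕ)
    [SFinite (averagedImage T μ n)] (p : FiniteMeasure G) (f : G →ᵇ ℝ≥0) :
    ∫⁻ x, f x ∂((p : Measure G) ∗ₘ averagedImage T μ n) =
      ∫⁻ h, ∑ A ∈ partitionFinset G n, (leftTranslate h p : Measure G) A / μ A *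
        ∫⁻ x, f (h⁻¹ * x) ∂(T (restrictFinite μ A) : Measure G) ∂μ := by
  have hf : Measurable fun x => (f x : ℝ≥0∞) := f.continuous.measurable.coe_nnreal_ennreal
  have : ∀ A, SFinite ((μ.restrict A).map (·⁻¹) ∗ₘ (T (restrictFinite μ A) : Measure G)) :=
    fun A => by rw [Measure.mconv]; infer_instance
  have inner : ∀ g, ∫⁻ x, f (g * x) ∂(averagedImage T μ n) =
      ∑ A ∈ partitionFinset G n, (μ A)⁻¹ * ∫⁻ h in A, ∫⁻ y, f (g * (h⁻¹ * y))
        ∂(T (restrictFinite μ A) : Measure G) ∂μ := fun g => by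
    rw [averagedImage, lintegral_finsetSum_measure]
    refine Finset.sum_congr rfl fun A _ => ?_
    have hg : Measurable fun x => (f (g * x) : ℝ≥0∞) := hf.comp (measurable_const_mul g)
    rw [lintegral_smul_measure, Measure.lintegral_mconv hg, lintegral_map _ measurable_inv]
    · rfl
    · exact Measurable.lintegral_prod_right' (f := fun z : G × G => (f (g * (z.1 * z.2)) : ℝ≥0∞))
        (hf.comp (by fun_prop))
  have shift : ∀ {A}, MeasurableSet A → ∀ g,
      ∫⁻ h in A, ∫⁻ y, f (g * (h⁻¹ * y)) ∂(T (restrictFinite μ A) : Measure G) ∂μ =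
        ∫⁻ h, A.indicator 1 (h * g) *
          ∫⁻ x, f (h⁻¹ * x) ∂(T (restrictFinite μ A) : Measure G) ∂μ := fun {A} hA g => by
    rw [← lintegral_indicator hA, ← lintegral_mul_right_eq_self _ g]
    refine lintegral_congr fun h => ?_
    by_cases hh : h * g ∈ A
    · simp [hh, mul_assoc]
    · simp [hh]
  rw [Measure.lintegral_mconv hf]
  simp only [inner]
  rw [lintegral_finsetSum' _ fun A hA => ?_, lintegral_finsetSum' _ fun A hA => ?_]
  · refine Finset.sum_congr rfl fun A hA => ?_
    have hA' := measurableSet_of_mem_partitionFinset hA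
    have hjoint : Measurable fun z : G × G => A.indicator (1 : G → ℝ≥0∞) (z.2 * z.1) *
        ∫⁻ x, f (z.2⁻¹ * x) ∂(T (restrictFinite μ A) : Measure G) :=
      ((measurable_one.indicator hA').comp (by fun_prop)).mul ((measurable_lintegral_inv_mul f _).comp measurable_snd)
    simp only [shift hA', leftTranslate_apply p hA', div_eq_mul_inv, mul_right_comm _ (μ A)⁻¹]
    rw [lintegral_const_mul _ hjoint.lintegral_prod_right', lintegral_mul_const _
      (by
        simp only [← leftTranslate_apply p hA']
        exact (measurable_leftTranslate_apply p hA').mul (measurable_lintegral_inv_mul f _)),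
      mul_comm]
    congr 1
    rw [lintegral_lintegral_swap hjoint.aemeasurable]
    refine lintegral_congr fun h => ?_
    dsimp only
    exact lintegral_mul_const _ (f := fun g => A.indicator (1 : G → ℝ≥0∞) (h * g))
      ((measurable_one.indicator hA').comp (measurable_const_mul h))
  · exact ((measurable_leftTranslate_apply p (measurableSet_of_mem_partitionFinset hA)).div_const _ |>.mul
      (measurable_lintegral_inv_mul f _)).aemeasurable
  · have hA' := measurableSet_of_mem_partitionFinset hA
    simp only [shift hA']
    exact (Measurable.lintegral_prod_right' (f := fun z : G × G =>
      A.indicator (1 : G → ℝ≥0∞) (z.2 * z.1) *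
        ∫⁻ x, f (z.2⁻¹ * x) ∂(T (restrictFinite μ A) : Measure G))
      (((measurable_one.indicator hA').comp (by fun_prop)).mul
        ((measurable_lintegral_inv_mul f _).comp measurable_snd))).const_mul _ |>.aemeasurable

/-- The left translate of a bounded continuous function. -/
noncomputable def translateFun (f : G →ᵇ ℝ≥0) (h : G) : G →ᵇ ℝ≥0 :=
  f.compContinuous ⟨fun x => h * x, continuous_const_mul h⟩

/-- If `T` commutes with the left translations of `p`, then `T p` is the limit of the convolutions
of `p` with the averaged images. -/
theorem tendsto_lintegral_mconv_averagedImage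
    {T : FiniteMeasure G →ₗ[ℝ≥0] FiniteMeasure G} (hT : ∀ m, (T m).mass = m.mass)
    {μ : Measure G} [IsProbabilityMeasure μ] [μ.IsMulLeftInvariant] [μ.IsMulRightInvariant]
    {p : FiniteMeasure G} (hp : (p : Measure G) ≪ μ)
    (hcov : ∀ h, T (leftTranslate h p) = leftTranslate h (T p)) (f : G →ᵇ ℝ≥0) :
    Tendsto (fun n => ∫⁻ x, f x ∂((p : Measure G) ∗ₘ averagedImage T μ n)) atTop
      (𝓝 (∫⁻ x, f x ∂(T p : Measure G))) := by
  have : ∀ n, IsProbabilityMeasure (averagedImage T μ n) := fun n => ⟨averagedImage_univ hT μ n⟩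
  simp only [lintegral_mconv_averagedImage]
  -- The limit is written as the `μ`-average of a constant, so that dominated convergence in `h`
  -- applies with the constant bound `‖f‖ p(G)`.
  have hlim : ∫⁻ x, f x ∂(T p : Measure G) = ∫⁻ _, ∫⁻ x, f x ∂(T p : Measure G) ∂μ := by simp
  rw [hlim]
  refine tendsto_lintegral_filter_of_dominated_convergence
    (fun _ => (nndist f 0 : ℝ≥0∞) * (p : Measure G) Set.univ) (.of_forall fun n => ?_)
    (.of_forall fun n => ae_of_all _ fun h => ?_) ?_ (ae_of_all _ fun h => ?_)
  · exact Finset.measurable_sum _ fun A hA => ((measurable_leftTranslate_apply p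
      (measurableSet_of_mem_partitionFinset hA)).div_const _).mul (measurable_lintegral_inv_mul f _)
  · calc _ ≤ ∑ A ∈ partitionFinset G n, (leftTranslate h p : Measure G) A / μ A *
          (nndist f 0 * μ A) := by
          gcongr with A hA
          have h2 := lintegral_le_norm_mul f (T (restrictFinite μ A) : Measure G) (h⁻¹ * ·)
          rw [toMeasure_linearMap_univ hT] at h2
          exact h2.trans_eq (congrArg _ (Measure.restrict_apply_univ A))
      _ = _ := by
          have hq := leftTranslate_absolutelyContinuous hp h
          simp only [mul_left_comm _ (nndist f 0 : ℝ≥0∞), div_mul_self_of_absolutelyContinuous hq]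
          rw [← Finset.mul_sum, sum_measure_partitionFinset]
          congr 1
          exact (Measure.map_apply (measurable_const_mul h) MeasurableSet.univ)
  · rw [lintegral_const, measure_univ (μ := μ), mul_one]
    exact ENNReal.mul_ne_top ENNReal.coe_ne_top (measure_ne_top _ _)
  -- For fixed `h` the test function is `f (h⁻¹ * ·)`; its translation cancels the one in `T (hp) =
  -- h (T p)`.
  · have h1 := tendsto_lintegral_partition hT (leftTranslate_absolutelyContinuous hp h)
      (translateFun f h⁻¹)
    rw [hcov h] at h1
    have h2 : ∫⁻ x, translateFun f h⁻¹ x ∂(leftTranslate h (T p) : Measure G) =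
        ∫⁻ x, f x ∂(T p : Measure G) := by
      refine (lintegral_map
        (translateFun f h⁻¹).continuous.measurable.coe_nnreal_ennreal
        (measurable_const_mul h)).trans (lintegral_congr fun x => ?_)
      simp [translateFun]
    rw [h2] at h1
    exact h1

end Group

/-! ### Weak limits and convolution on a compact group -/

section CompactGroup

open Filter Topology BoundedContinuousFunction

variable {G : Type*} [MeasurableSpace G] [Group G] [TopologicalSpace G] [IsTopologicalGroup G]
  [SecondCountableTopology G] [BorelSpace G] [CompactSpace G]

/-- The right translates of `f`, averaged over `p`. -/
noncomputable def averagedFun (p : FiniteMeasure G) (f : G →ᵇ ℝ≥0) : G →ᵇ ℝ≥0 :=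
  BoundedContinuousFunction.mkOfCompact
    ⟨fun x => (∫⁻ g, f (g * x) ∂(p : Measure G)).toNNReal, by
      rw [continuous_iff_continuousAt]
      intro x
      have hfin : ∫⁻ g, f (g * x) ∂(p : Measure G) ≠ ∞ :=
        ((lintegral_le_norm_mul f (p : Measure G) (· * x)).trans_lt
          (ENNReal.mul_lt_top ENNReal.coe_lt_top (measure_lt_top _ _))).ne
      refine (ENNReal.tendsto_toNNReal hfin).comp
        (tendsto_lintegral_filter_of_dominated_convergence (fun _ => (nndist f 0 : ℝ≥0∞))
          (.of_forall fun y => f.continuous.measurable.coe_nnreal_ennreal.comp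
            (measurable_mul_const y))
          (.of_forall fun y => ae_of_all _ fun g =>
            ENNReal.coe_le_coe.2 (BoundedContinuousFunction.NNReal.upper_bound f _))
          (by
            rw [lintegral_const]
            exact ENNReal.mul_ne_top ENNReal.coe_ne_top (measure_ne_top _ _))
          (ae_of_all _ fun g => ?_))
      exact (ENNReal.continuous_coe.comp (f.continuous.comp (continuous_const_mul g))).tendsto x⟩

/-- Tonelli moves `p` from the measure to the test function, which stays continuous. Hence weak
convergence of measures passes to their convolutions with `p`. -/
theorem lintegral_averagedFun (p : FiniteMeasure G) (f : G →ᵇ ℝ≥0) (ν : Measure G) [SFinite ν] :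
    ∫⁻ x, averagedFun p f x ∂ν = ∫⁻ x, f x ∂((p : Measure G) ∗ₘ ν) := by
  have hf : Measurable fun x => (f x : ℝ≥0∞) := f.continuous.measurable.coe_nnreal_ennreal
  rw [Measure.lintegral_mconv hf, lintegral_lintegral_swap
    (f := fun g x => (f (g * x) : ℝ≥0∞)) (hf.comp measurable_mul).aemeasurable]
  refine lintegral_congr fun x => ENNReal.coe_toNNReal ?_
  exact ((lintegral_le_norm_mul f (p : Measure G) (· * x)).trans_lt
    (ENNReal.mul_lt_top ENNReal.coe_lt_top (measure_lt_top _ _))).ne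

/-- A mass preserving linear map on the finite measures of a compact group is given by convolution
with a fixed probability measure on all absolutely continuous measures whose left translations it
commutes with. -/
theorem exists_mconv_eq [T2Space G]
    {T : FiniteMeasure G →ₗ[ℝ≥0] FiniteMeasure G} (hT : ∀ m, (T m).mass = m.mass)
    (μ : Measure G) [IsProbabilityMeasure μ] [μ.IsMulLeftInvariant] [μ.IsMulRightInvariant] :
    ∃ ν : ProbabilityMeasure G, ∀ p : FiniteMeasure G, (p : Measure G) ≪ μ →
      (∀ h, T (leftTranslate h p) = leftTranslate h (T p)) →
      (T p : Measure G) = (p : Measure G) ∗ₘ (ν : Measure G) := by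
  let νs : ℕ → ProbabilityMeasure G := fun n => ⟨averagedImage T μ n, ⟨averagedImage_univ hT μ n⟩⟩
  -- The probability measures on `G` are weakly compact, so the ultrafilter converges. It is fixed
  -- before `p`, hence one `ν` serves all `p`.
  have hlim : Tendsto νs (hyperfilter ℕ) (𝓝 ((hyperfilter ℕ).map νs).lim) :=
    Ultrafilter.le_nhds_lim _
  refine ⟨((hyperfilter ℕ).map νs).lim, fun p hp hcov => ?_⟩
  refine ext_of_forall_lintegral_eq_of_IsFiniteMeasure fun f => ?_
  have h1 := (tendsto_lintegral_mconv_averagedImage hT hp hcov f).mono_left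
    Nat.hyperfilter_le_atTop
  have h2 := ProbabilityMeasure.tendsto_iff_forall_lintegral_tendsto.1 hlim (averagedFun p f)
  rw [lintegral_averagedFun] at h2
  refine tendsto_nhds_unique h1 (h2.congr fun n => ?_)
  exact lintegral_averagedFun p f (νs n : Measure G)

end CompactGroup

/-! ### Pure states and the scalar measures of an observable -/

section PureStates

variable {H : Type*} [NormedAddCommGroup H] [InnerProductSpace ℂ H]

theorem rankOne_self_nonneg (x : H) : 0 ≤ InnerProductSpace.rankOne ℂ x x :=
  (ContinuousLinearMap.nonneg_iff_isPositive _).2 (InnerProductSpace.isPositive_rankOne_self x)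

variable [CompleteSpace H]

/-- Parseval for `T* x` and `x`. The case `T = 1` makes the rank one projection a state, and `T = E
X` gives its outcome distribution. -/
theorem hasSum_inner_rankOne_mul (x : H) (T : H →L[ℂ] H) :
    HasSum (fun i => ⟪hBasis H i, (InnerProductSpace.rankOne ℂ x x * T) (hBasis H i)⟫_ℂ)
      ⟪x, T x⟫_ℂ := by
  have h := (hBasis H).hasSum_inner_mul_inner (ContinuousLinearMap.adjoint T x) x
  rw [ContinuousLinearMap.adjoint_inner_left] at h
  have e : (fun i => ⟪hBasis H i, (InnerProductSpace.rankOne ℂ x x * T) (hBasis H i)⟫_ℂ) =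
      fun i => ⟪ContinuousLinearMap.adjoint T x, hBasis H i⟫_ℂ * ⟪hBasis H i, x⟫_ℂ := by
    funext i
    rw [ContinuousLinearMap.adjoint_inner_left, mul_apply_eq_comp,
      InnerProductSpace.rankOne_apply, inner_smul_right]
  rw [e]
  exact h

/-- The pure state of a unit vector. -/
noncomputable def pureState (x : H) (hx : ‖x‖ = 1) : QuantumState H where
  op := InnerProductSpace.rankOne ℂ x x
  nonneg := rankOne_self_nonneg x
  traceClass := by
    rw [IsTraceClass, CFC.abs_of_nonneg _ (rankOne_self_nonneg x)]
    simpa using (Complex.hasSum_re (hasSum_inner_rankOne_mul x 1)).summable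
  trace_eq_one := by
    have h := (hasSum_inner_rankOne_mul x 1).tsum_eq
    rw [mul_one, one_apply_eq_self, inner_self_eq_norm_sq_to_K, hx] at h
    simpa [opTrace] using h

variable {Ω : Type*} [MeasurableSpace Ω]

theorem QObservable.outcomeMeasure_pureState (E : QObservable Ω H) (x : H) (hx : ‖x‖ = 1) :
    E.outcomeMeasure (pureState x hx) = E.scalarMeasure x := by
  ext X hX
  rw [E.outcomeMeasure_apply _ hX, E.scalarMeasure_apply x hX,
    ← (hasSum_inner_rankOne_mul x (E X)).tsum_eq]
  rfl

theorem QObservable.scalarMeasure_univ (E : QObservable Ω H) (x : H) :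
    E.scalarMeasure x Set.univ = ENNReal.ofReal (‖x‖ ^ 2) := by
  rw [E.scalarMeasure_apply x MeasurableSet.univ, E.univ, one_apply_eq_self,
    inner_self_eq_norm_sq_to_K]
  norm_cast

instance (E : QObservable Ω H) (x : H) : IsFiniteMeasure (E.scalarMeasure x) :=
  ⟨by rw [E.scalarMeasure_univ]; exact ENNReal.ofReal_lt_top⟩

theorem QObservable.scalarMeasure_smul (E : QObservable Ω H) (c : ℂ) (x : H) :
    E.scalarMeasure (c • x) = ENNReal.ofReal (‖c‖ ^ 2) • E.scalarMeasure x := by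
  ext X hX
  rw [Measure.smul_apply, smul_eq_mul, E.scalarMeasure_apply _ hX, E.scalarMeasure_apply _ hX,
    ← ENNReal.ofReal_mul (by positivity), map_smul, inner_smul_left, inner_smul_right, ← mul_assoc,
    Complex.conj_mul', ← Complex.ofReal_pow, Complex.re_ofReal_mul]

theorem QObservable.inner_eq_measureReal (E : QObservable Ω H) (x : H) {X : Set Ω}
    (hX : MeasurableSet X) : ⟪x, E X x⟫_ℂ = ((E.scalarMeasure x).real X : ℂ) := by
  rw [Measure.real, E.scalarMeasure_apply x hX, ENNReal.toReal_ofReal (E.re_inner_nonneg X x)]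
  have hp := (ContinuousLinearMap.nonneg_iff_isPositive _).1 (E.nonneg X hX)
  exact Complex.ext rfl (by simpa using ((Complex.nonneg_iff.1 (hp.inner_nonneg_right x)).2).symm)

end PureStates

/-! ### Consequences of covariance -/

section Covariant

open Filter Topology

variable {H : Type*} [NormedAddCommGroup H] [InnerProductSpace ℂ H] [CompleteSpace H]
variable {G : Type*} [MeasurableSpace G] [Group G] [TopologicalSpace G]

theorem QObservable.IsCovariant.scalarMeasure_map_mul_left [MeasurableMul G]
    {E : QObservable G H} {U : UnitaryRep G H}
    (hE : E.IsCovariant U) (h : G) (x : H) :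
    (E.scalarMeasure x).map (h * ·) = E.scalarMeasure ((U.toHom h : H →L[ℂ] H) x) := by
  ext X hX
  have hpre : (h * ·) ⁻¹' X = h⁻¹ • X := Set.preimage_smul h X
  have hX' : MeasurableSet (h⁻¹ • X) := hpre ▸ measurable_const_mul h hX
  -- Covariance is applied at `h⁻¹`, where `U(h⁻¹) = U(h)*`.
  rw [Measure.map_apply (measurable_const_mul h) hX, hpre, E.scalarMeasure_apply _ hX',
    E.scalarMeasure_apply _ hX, ← hE h⁻¹ X hX, map_inv, ← Unitary.star_eq_inv, Unitary.coe_star,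
    star_star, mul_apply_eq_comp, mul_apply_eq_comp,
    ContinuousLinearMap.star_eq_adjoint, ContinuousLinearMap.adjoint_inner_right]

/-- A covariant observable is absolutely continuous with respect to the Haar measure. -/
theorem QObservable.IsCovariant.scalarMeasure_absolutelyContinuous [IsTopologicalGroup G]
    [SecondCountableTopology G] [BorelSpace G] {E : QObservable G H} {U : UnitaryRep G H}
    (hE : E.IsCovariant U) (μ : Measure G) [SFinite μ] [μ.IsMulRightInvariant]
    [μ.IsOpenPosMeasure] (x : H) : E.scalarMeasure x ≪ μ := by
  refine Measure.AbsolutelyContinuous.mk fun X hX h0 => ?_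
  -- By Tonelli and right invariance, `F` has integral `μ X * E_x(G) = 0`. It is nonnegative and, by
  -- strong continuity of `U`, continuous, so it vanishes identically since `μ` charges open sets;
  -- its value at `1` is `E_x(X)`.
  let F : G → ℝ≥0∞ := fun g => E.scalarMeasure ((U.toHom g : H →L[ℂ] H) x) X
  have hF : Continuous F := by
    simp only [F, E.scalarMeasure_apply _ hX]
    exact ENNReal.continuous_ofReal.comp (Complex.continuous_re.comp
      ((U.continuous_apply x).inner ((E X).continuous.comp (U.continuous_apply x))))
  have hind : Measurable (X.indicator (1 : G → ℝ≥0∞)) := measurable_one.indicator hX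
  have hFint : ∫⁻ g, F g ∂μ = 0 := by
    have h1 : ∀ g, F g = ∫⁻ k, X.indicator 1 (g * k) ∂(E.scalarMeasure x) := fun g => by
      rw [← lintegral_map hind (measurable_const_mul g), lintegral_indicator_one hX,
        hE.scalarMeasure_map_mul_left]
    simp only [h1]
    rw [lintegral_lintegral_swap
      (f := fun g k => X.indicator (1 : G → ℝ≥0∞) (g * k)) (hind.comp measurable_mul).aemeasurable]
    simp only [lintegral_mul_right_eq_self (X.indicator (1 : G → ℝ≥0∞)),
      lintegral_indicator_one hX, h0, lintegral_zero]
  have hF0 : F = fun _ => 0 :=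
    hF.ae_eq_iff_eq μ continuous_const |>.1 ((lintegral_eq_zero_iff hF.measurable).1 hFint)
  have h1 := congrFun hF0 1
  simpa [F] using h1

end Covariant

/-! ### Smearing as convolution of scalar measures -/

section Smearing

variable {G : Type*} [MeasurableSpace G] [Group G]
variable {H : Type*} [NormedAddCommGroup H] [InnerProductSpace ℂ H] [CompleteSpace H]

/-- Both sides scale by `‖x‖²`. Pure states only give information on unit vectors. -/
theorem QObservable.scalarMeasure_eq_mconv_of_unit {F E : QObservable G H} {ν : Measure G} [SFinite ν]
    (h : ∀ x, ‖x‖ = 1 → F.scalarMeasure x = E.scalarMeasure x ∗ₘ ν) (x : H) :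
    F.scalarMeasure x = E.scalarMeasure x ∗ₘ ν := by
  rcases eq_or_ne x 0 with rfl | hx
  · have h0 : ∀ E : QObservable G H, E.scalarMeasure 0 = 0 := fun E => by
      rw [← Measure.measure_univ_eq_zero, E.scalarMeasure_univ]
      simp
    rw [h0, h0, Measure.zero_mconv]
  · have hx0 : (‖x‖ : ℂ) ≠ 0 := by simpa using hx
    have hu : ‖(‖x‖ : ℂ)⁻¹ • x‖ = 1 := by
      rw [norm_smul, norm_inv, Complex.norm_real, norm_norm, inv_mul_cancel₀ (by simpa using hx)]
    have hxu : x = (‖x‖ : ℂ) • ((‖x‖ : ℂ)⁻¹ • x) := by rw [smul_smul, mul_inv_cancel₀ hx0, one_smul]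
    rw [hxu, F.scalarMeasure_smul (‖x‖ : ℂ), E.scalarMeasure_smul (‖x‖ : ℂ), Measure.mconv_smul_left, h _ hu]

variable [MeasurableMul₂ G]

theorem mconv_apply (p ν : Measure G) [SFinite ν] {X : Set G} (hX : MeasurableSet X) :
    (p ∗ₘ ν) X = ∫⁻ g, ν (g⁻¹ • X) ∂p := by
  rw [Measure.mconv, Measure.map_apply measurable_mul hX, Measure.prod_apply (measurable_mul hX)]
  refine lintegral_congr fun g => congrArg ν ?_
  exact Set.preimage_smul g X

theorem measurable_measure_inv_smul (ν : Measure G) [SFinite ν] {X : Set G}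
    (hX : MeasurableSet X) : Measurable fun g : G => ν (g⁻¹ • X) := by
  have h := measurable_measure_prodMk_left (ν := ν) (measurable_mul hX)
  convert h using 2 with g
  exact congrArg ν (Set.preimage_smul g X).symm

theorem sum_mconv {ι : Type*} (p : ι → Measure G) (ν : Measure G) [SFinite ν] :
    Measure.sum p ∗ₘ ν = Measure.sum fun i => p i ∗ₘ ν := by
  ext X hX
  rw [mconv_apply _ _ hX, lintegral_sum_measure, Measure.sum_apply _ hX]
  simp only [mconv_apply _ _ hX]

/-- Convolution on the right with a probability measure. -/
noncomputable def mconvProb (ν p : ProbabilityMeasure G) : ProbabilityMeasure G :=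
  ⟨(p : Measure G) ∗ₘ (ν : Measure G), inferInstance⟩

theorem isAffineProbMap_mconvProb (ν : ProbabilityMeasure G) : IsAffineProbMap (mconvProb ν) := by
  intro t p q
  refine Subtype.ext ?_
  change (ENNReal.ofReal (t : ℝ) • (p : Measure G) + ENNReal.ofReal (1 - (t : ℝ)) •
    (q : Measure G)) ∗ₘ (ν : Measure G) = ENNReal.ofReal (t : ℝ) • ((p : Measure G) ∗ₘ ν) +
    ENNReal.ofReal (1 - (t : ℝ)) • ((q : Measure G) ∗ₘ ν)
  have h1 : IsFiniteMeasure (ENNReal.ofReal (t : ℝ) • (p : Measure G)) :=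
    Measure.smul_finite _ ENNReal.ofReal_ne_top
  have h2 : IsFiniteMeasure (ENNReal.ofReal (1 - (t : ℝ)) • (q : Measure G)) :=
    Measure.smul_finite _ ENNReal.ofReal_ne_top
  rw [Measure.add_mconv, Measure.mconv_smul_left, Measure.mconv_smul_left]

namespace QObservable

theorem outcomeMeasure_eq_sum {Ω : Type*} [MeasurableSpace Ω] (E : QObservable Ω H)
    (ρ : QuantumState H) :
    E.outcomeMeasure ρ = Measure.sum fun j => E.scalarMeasure (ρ.vec j) := by
  ext X hX
  rw [E.outcomeMeasure_apply ρ hX, E.ofReal_re_opTrace ρ hX]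

/-- The integral of `ν (g⁻¹ • X)` against a measure `p` is `(p ∗ₘ ν) X`, so the weak operator
integral is a family of convolution identities between finite measures. -/
theorem isSmearing_iff (F E : QObservable G H) (ν : ProbabilityMeasure G) :
    F.IsSmearing E ν ↔ ∀ x, F.scalarMeasure x = E.scalarMeasure x ∗ₘ (ν : Measure G) := by
  have hint : ∀ {X : Set G}, MeasurableSet X → ∀ x,
      Integrable (fun g => (ν (g⁻¹ • X) : ℝ)) (E.scalarMeasure x) := fun {X} hX x =>
    Integrable.of_bound
      (measurable_measure_inv_smul (ν : Measure G) hX).ennreal_toReal.aestronglyMeasurable 1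
      (ae_of_all _ fun g => by
        rw [NNReal.norm_eq]
        exact_mod_cast ν.apply_le_one _)
  have hval : ∀ {X : Set G}, MeasurableSet X → ∀ x,
      ∫ g, (ν (g⁻¹ • X) : ℝ) ∂(E.scalarMeasure x) =
        (E.scalarMeasure x ∗ₘ (ν : Measure G)).real X := fun {X} hX x => by
    rw [Measure.real, mconv_apply _ _ hX, ← integral_toReal
      (measurable_measure_inv_smul (ν : Measure G) hX).aemeasurable
      (ae_of_all _ fun g => measure_lt_top _ _)]
    rfl
  refine ⟨fun h x => ?_, fun h X hX x => ⟨hint hX x, ?_⟩⟩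
  · ext X hX
    have h1 := (h X hX x).2
    rw [hval hX, F.inner_eq_measureReal x hX, Complex.ofReal_inj] at h1
    exact (measureReal_eq_measureReal_iff).1 h1
  · rw [hval hX, F.inner_eq_measureReal x hX, h x]

/-- The outcome distribution in any state is a sum of scalar measures, and convolution with `ν`
commutes with sums. -/
theorem IsSmearing.isPostprocessingOf {F E : QObservable G H} {ν : ProbabilityMeasure G}
    (h : F.IsSmearing E ν) : F.IsPostprocessingOf E := by
  refine ⟨mconvProb ν, isAffineProbMap_mconvProb ν, funext fun ρ => Subtype.ext ?_⟩
  change F.outcomeMeasure ρ = E.outcomeMeasure ρ ∗ₘ (ν : Measure G)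
  simp only [outcomeMeasure_eq_sum, sum_mconv, (isSmearing_iff F E ν).1 h]

end QObservable

end Smearing

/-! ### Haar measure and the equivalence -/

/-- The Haar probability measure of a compact group is right invariant. -/
theorem isMulRightInvariant_of_isProbabilityMeasure {G : Type*} [Group G] [TopologicalSpace G]
    [IsTopologicalGroup G] [LocallyCompactSpace G] [MeasurableSpace G] [BorelSpace G]
    (μ : Measure G) [μ.IsHaarMeasure] [IsProbabilityMeasure μ] : μ.IsMulRightInvariant :=
  ⟨fun g => by
    have : IsProbabilityMeasure (μ.map (· * g)) :=
      Measure.isProbabilityMeasure_map (measurable_mul_const g).aemeasurable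
    -- A right translate of `μ` is again a Haar probability measure, and that is unique.
    exact Measure.isHaarMeasure_eq_of_isProbabilityMeasure _ _⟩

theorem QObservable.IsPostprocessingOf.exists_isSmearing
    {G : Type*} [Group G] [TopologicalSpace G] [IsTopologicalGroup G] [CompactSpace G] [T2Space G]
    [SecondCountableTopology G] [MeasurableSpace G] [BorelSpace G]
    {H : Type*} [NormedAddCommGroup H] [InnerProductSpace ℂ H] [CompleteSpace H]
    {U : UnitaryRep G H} {E F : QObservable G H}
    (hE : E.IsCovariant U) (hF : F.IsCovariant U) (h : F.IsPostprocessingOf E) :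
    ∃ ν : ProbabilityMeasure G, F.IsSmearing E ν := by
  obtain ⟨Ψ, hΨ, hcomp⟩ := h
  let μ : Measure G := Measure.haarMeasure ⊤
  have hμ : IsProbabilityMeasure μ := ⟨Measure.haarMeasure_self⟩
  have hμr := isMulRightInvariant_of_isProbabilityMeasure μ
  obtain ⟨ν, hν⟩ := exists_mconv_eq hΨ.mass_linearExtension μ
  refine ⟨ν, (QObservable.isSmearing_iff F E ν).2 (QObservable.scalarMeasure_eq_mconv_of_unit fun x hx => ?_)⟩
  have hT : ∀ y, ‖y‖ = 1 → hΨ.linearExtension ⟨E.scalarMeasure y, inferInstance⟩ =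
      ⟨F.scalarMeasure y, inferInstance⟩ := fun y hy => by
    have h1 : ∀ D : QObservable G H, (D.outcomeDist (pureState y hy)).toFiniteMeasure =
        ⟨D.scalarMeasure y, inferInstance⟩ := fun D =>
      Subtype.ext (D.outcomeMeasure_pureState y hy)
    rw [← h1 E, ← h1 F, hΨ.linearExtension_apply, hcomp]
    rfl
  have htr : ∀ (D : QObservable G H), D.IsCovariant U → ∀ h,
      leftTranslate h ⟨D.scalarMeasure x, inferInstance⟩ =
        (⟨D.scalarMeasure ((U.toHom h : H →L[ℂ] H) x), inferInstance⟩ : FiniteMeasure G) :=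
    fun D hD h => Subtype.ext (hD.scalarMeasure_map_mul_left h x)
  -- With `h E_x` for the translate, `T (h E_x) = T E_{U(h)x} = F_{U(h)x} = h F_x = h (T E_x)`; the
  -- second equality needs `U(h) x` to be a unit vector.
  have h2 := hν ⟨E.scalarMeasure x, inferInstance⟩ (hE.scalarMeasure_absolutelyContinuous μ x)
    fun h => by
      rw [htr E hE, hT x hx, htr F hF, hT]
      rw [← hx]
      exact Unitary.norm_map (U.toHom h) x
  rw [hT x hx] at h2
  exact h2

theorem mainTheorem2
    {G : Type*} [Group G] [TopologicalSpace G] [IsTopologicalGroup G] [CompactSpace G] [T2Space G]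
    [SecondCountableTopology G] [MeasurableSpace G] [BorelSpace G]
    {H : Type*} [NormedAddCommGroup H] [InnerProductSpace ℂ H] [CompleteSpace H]
    [TopologicalSpace.SeparableSpace H]
    (U : UnitaryRep G H) (E F : QObservable G H)
    (hE : E.IsCovariant U) (hF : F.IsCovariant U) :
    F.IsPostprocessingOf E ↔ ∃ ν : ProbabilityMeasure G, F.IsSmearing E ν := by
  exact ⟨fun h => h.exists_isSmearing hE hF, fun ⟨_, hν⟩ => hν.isPostprocessingOf⟩
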